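/- **Setting.** A finite set of processes, some of which may crash, is connected by reliable FIFO channels. There are finitely many pairwise disjoint groups of $2f+1$ processes, at most $f$ of which crash in each group, and every application message $m$ has a set $\mathrm{dest}(m)$ of destination groups. A run is a sequence of events (in particular $\mathrm{multicast}(m)$ and $\mathrm{deliver}(m)$ events at processes, every message being multicast at most once) with non-decreasing real times tending to infinity; each run has a global stabilisation time $\mathsf{GST}$, after which no process crashes and protocol messages take at most a time $\delta$. A process is correct in a run if it never crashes in it. A protocol is given by its set of runs. It implements atomic multicast if all its runs satisfy Validity (a member of a group $g$ delivers $m$ only after $m$ was multicast, and only if $g\in\mathrm{dest}(m)$), Integrity (a process delivers $m$ at most once), Ordering (there is a total order on the messages multicast such that a process that delivers $m$ has delivered before it every smaller message addressed to its group) and Termination (a message multicast by a correct process or delivered by any process is eventually delivered by $f+1$ members of each of its destination groups). **Skeen-based protocols.** A protocol $\mathcal A$ that implements atomic multicast is *Skeen-based* if the following holds. Timestamps are pairs (integer, group) in lexicographic order. 1. In every run there are a time $t\ge\mathsf{GST}$ and for each group $g$ a correct member $\ell_g$, the leader of $g$, such that from $t$ on $\ell_g$ is permanently in the leader role, no other correct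 member of $g$ is, a quorum ($f+1$ correct members of $g$, including $\ell_g$) permanently follows $\ell_g$, and all correct processes take $\ell_g$ to be the leader of $g$. We then call the run *stable from $t$*. 2. A process handles a message $m$ (moves it out of its initial phase) only if $m$ was multicast before and the process is in a destination group of $m$. While a process is the leader of a group $g$, it treats messages as in Skeen's protocol: it proposes $m$ by incrementing its clock, to $c$ say, and taking $(c,g)$ as the local timestamp of $m$; it commits a proposed $m$ by fixing as its global timestamp the maximum of local timestamps that $m$ got in its destination groups, one from each group, and making sure that its clock is not below it; it may increase its clock at any time. A committed, undelivered message is *deliverable* at the leader when every proposed but uncommitted message there has a local timestamp above the global timestamp of that message. A leader delivers only deliverable messages, in the order of global timestamps, and does so at the very time at which they become deliverable (unless it crashes or loses the leader role at that time). A member of a group that is not a leader delivers only messages that a leader of the group has delivered before. 3. Messages are processed independently of each other until they are committed: for every run that is stable from $t$ and every set $X$ of messages there is a run of $\mathcal A$ with the same crashes, the same $\mathsf{GST}$ and the same leaders, stable from $t$, in which the same messages are multicast (at the same times by the same processes) except that those multicast after $t$ and outside $X$ are erased, and in which the messages of $X$ multicast after $t$ are committed by the leaders $\ell_g$ at the same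 times as in the given run. **Latencies.** A message is partially delivered when it has been delivered by some process in each of its destination groups; two messages are concurrent if each is multicast before the other is partially delivered, and conflicting if they have a common destination group. The *collision-free latency* of $\mathcal A$ is the least $\Delta\in[0,\infty]$ such that in every run there is a time $t\ge\mathsf{GST}$ such that every message $m$ that is multicast after $t$ and does not conflict with any other concurrent message multicast by a correct process is delivered, in each group of $\mathrm{dest}(m)$, by some member of the group within time $\Delta$ of being multicast. The *commit latency* $D$ of $\mathcal A$ is the maximal time from multicasting a message, after stabilisation, to its being committed by the leader of a destination group; that is, the least $\Delta\in[0,\infty]$ such that every run is stable from some time $t$ such that every message $m$ (colliding or not) multicast after $t$ is committed by the leader of each group of $\mathrm{dest}(m)$ within time $\Delta$ of being multicast. (If the finite bounds have no least element, the infimum is meant.) **Theorem.** For every Skeen-based atomic multicast protocol $\mathcal A$, the collision-free latency equals the commit latency $D$. More precisely, for each real $\Delta\ge 0$, $\Delta$ is a bound as in the definition of the collision-free latency if and only if it is a bound as in the definition of the commit latency. -/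

import Mathlib

open Filter
open scoped NNReal ENNReal

namespace AtomicMulticast

/-! ### System, timestamps, process variables, events -/

/-- The static data of the system: disjoint groups of `2 f + 1` processes each, and the set of
destination groups of every application message. -/
structure System (P G M : Type*) where
  members : G → Finset P
  disjoint : ∀ g h, g ≠ h → Disjoint (members g) (members h)
  f : ℕ
  card_members : ∀ g, (members g).card = 2 * f + 1
  dest : M → Finset G

/-- Timestamps are pairs of an integer and a group, ordered lexicographically. -/
abbrev Timestamp (G : Type*) := ℕ ×ₗ G

/-- The integer part of a timestamp. -/
def tsTime {G : Type*} (ts : Timestamp G) : ℕ := (ofLex ts).1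

/-- The phase of an application message at a process. (`accepted` is an intermediate phase that
fault-tolerant variants use; the original protocol goes from `proposed` to `committed`.) -/
inductive Phase where
  | start | proposed | accepted | committed

/-- The message has a local timestamp but is not committed. -/
def Phase.Pending (φ : Phase) : Prop := φ = .proposed ∨ φ = .accepted

inductive Status (P : Type*) where
  | leader
  | follower (p : P)
  | recovering

/-- The variables of a process that a Skeen-based protocol has (a concrete protocol may keep
further ones). -/
structure Vars (P G M : Type*) where
  clock : ℕ
  phase : M → Phase
  localTS : M → Timestamp G
  globalTS : M → Timestamp G
  status : Status P
  curLeader : G → P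

/-- What a process can do in one atomic step; `Pkt` is the type of protocol messages. -/
inductive Event (P M Pkt : Type*) where
  /-- `multicast(m)` -/
  | multicast (m : M)
  /-- `deliver(m)` -/
  | deliver (m : M)
  /-- send the protocol message `x` to `q` -/
  | send (q : P) (x : Pkt)
  /-- receive the protocol message `x` from `q` -/
  | receive (q : P) (x : Pkt)
  /-- assign a local timestamp to `m` -/
  | propose (m : M)
  /-- move `m` to the phase `accepted` -/
  | accept (m : M)
  /-- fix the global timestamp of `m` and move `m` to the phase `committed` -/
  | commit (m : M)
  | crash
  | internal

/-- A timed run: `event n` is the `n`-th event, with the process at which it occurs (`none` is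
an idle step, so that finite runs are included), `time n` is its time, `vars n p` are the
variables of `p` just before it, and `gst` is the global stabilisation time. -/
structure Run (P G M Pkt : Type*) where
  time : ℕ → ℝ
  event : ℕ → Option (P × Event P M Pkt)
  vars : ℕ → P → Vars P G M
  gst : ℝ

variable {P G M Pkt : Type*}

namespace Run

/-- The `n`-th event of the run is `e`, at process `p`. -/
def Occurs (r : Run P G M Pkt) (n : ℕ) (p : P) (e : Event P M Pkt) : Prop :=
  r.event n = some (p, e)

/-- A process is correct in a run if it never crashes in it. -/
def Correct (r : Run P G M Pkt) (p : P) : Prop := ∀ n, ¬ r.Occurs n p .crash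

/-! ### The system model -/

/-- Reliable FIFO channels whose delays are at most `δ` after the global stabilisation time.
`sendOf` matches every receive event with its send event. -/
def ReliableChannels (δ : ℝ≥0) (r : Run P G M Pkt) : Prop :=
  ∃ sendOf : ℕ → ℕ,
    (∀ k q p x, r.Occurs k q (.receive p x) →
      sendOf k < k ∧ r.Occurs (sendOf k) p (.send q x)) ∧
    (∀ k k' q p x x', r.Occurs k q (.receive p x) → r.Occurs k' q (.receive p x') → k < k' →
      sendOf k < sendOf k') ∧
    (∀ n p q x, r.Occurs n p (.send q x) → r.Correct p → r.Correct q →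
      ∃ k, r.Occurs k q (.receive p x) ∧ sendOf k = n) ∧
    (∀ k q p x, r.Occurs k q (.receive p x) → r.gst ≤ r.time (sendOf k) →
      r.time k ≤ r.time (sendOf k) + δ)

/-- The runs that the system model allows. -/
structure Admissible (S : System P G M) (δ : ℝ≥0) (r : Run P G M Pkt) : Prop where
  time_mono : Monotone r.time
  time_diverges : Tendsto r.time atTop atTop
  init : ∀ p, (r.vars 0 p).clock = 0 ∧ ∀ m, (r.vars 0 p).phase m = .start
  /-- only the process at which an event occurs changes its variables -/
  frame : ∀ n p, (∀ e, ¬ r.Occurs n p e) → r.vars (n + 1) p = r.vars n p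
  crash_stop : ∀ n k p e, r.Occurs n p .crash → n < k → ¬ r.Occurs k p e
  /-- failures cease at the global stabilisation time -/
  crash_le_gst : ∀ n p, r.Occurs n p .crash → r.time n ≤ r.gst
  faulty_le : ∀ g, {p | p ∈ S.members g ∧ ¬ r.Correct p}.ncard ≤ S.f
  /-- the messages multicast in a run are unique -/
  multicast_unique : ∀ n k p q m, r.Occurs n p (.multicast m) → r.Occurs k q (.multicast m) →
    n = k
  channels : r.ReliableChannels δ

/-! ### Atomic multicast -/

/-- The message `m` is multicast in the run. -/
def IsMulticast (r : Run P G M Pkt) (m : M) : Prop := ∃ n p, r.Occurs n p (.multicast m)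

/-- The correctness conditions of atomic multicast. -/
structure AtomicMulticastSpec (S : System P G M) (r : Run P G M Pkt) : Prop where
  validity : ∀ n p m g, r.Occurs n p (.deliver m) → p ∈ S.members g →
    (∃ k q, k < n ∧ r.Occurs k q (.multicast m)) ∧ g ∈ S.dest m
  integrity : ∀ n k p m, r.Occurs n p (.deliver m) → r.Occurs k p (.deliver m) → n = k
  ordering : ∃ lt : {m // r.IsMulticast m} → {m // r.IsMulticast m} → Prop,
    IsStrictTotalOrder {m // r.IsMulticast m} lt ∧
    ∀ m m', lt m' m → ∀ n p, r.Occurs n p (.deliver m.1) →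
      (∃ g ∈ S.dest m'.1, p ∈ S.members g) → ∃ k, k < n ∧ r.Occurs k p (.deliver m'.1)
  termination : ∀ m,
    ((∃ n p, r.Correct p ∧ r.Occurs n p (.multicast m)) ∨ ∃ n p, r.Occurs n p (.deliver m)) →
    ∀ g ∈ S.dest m, ∃ Q ⊆ S.members g, Q.card = S.f + 1 ∧
      ∀ q ∈ Q, ∃ n, r.Occurs n q (.deliver m)

/-- Before the `n`-th event, `m` has been delivered by some process in each of its destination
groups. -/
def PartiallyDeliveredBefore (S : System P G M) (r : Run P G M Pkt) (m : M) (n : ℕ) : Prop :=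
  ∀ g ∈ S.dest m, ∃ k < n, ∃ q ∈ S.members g, r.Occurs k q (.deliver m)

/-- Each of the two messages is multicast before the other one is partially delivered. -/
def Concurrent (S : System P G M) (r : Run P G M Pkt) (m m' : M) : Prop :=
  ∃ k p k' p', r.Occurs k p (.multicast m) ∧ r.Occurs k' p' (.multicast m') ∧
    ¬ r.PartiallyDeliveredBefore S m k' ∧ ¬ r.PartiallyDeliveredBefore S m' k

/-- `m` does not conflict with any (other) concurrent message multicast by a correct process. -/
def CollisionFree (S : System P G M) (r : Run P G M Pkt) (m : M) : Prop :=
  ∀ m', m' ≠ m → (∃ k p, r.Correct p ∧ r.Occurs k p (.multicast m')) →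
    (∃ g, g ∈ S.dest m ∧ g ∈ S.dest m') → ¬ r.Concurrent S m m'

/-! ### Skeen's rules -/

/-- From time `t` on every group `g` has `ℓ g` as its permanent, only leader: `ℓ g` and a quorum
of correct members that follow it do so permanently, and all correct processes know it. -/
structure StableFrom (S : System P G M) (r : Run P G M Pkt) (t : ℝ) (ℓ : G → P) : Prop where
  gst_le : r.gst ≤ t
  leader : ∀ g n, t ≤ r.time n → (r.vars n (ℓ g)).status = .leader
  quorum : ∀ g, ∃ Q ⊆ S.members g, Q.card = S.f + 1 ∧ ℓ g ∈ Q ∧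
    ∀ q ∈ Q, r.Correct q ∧
      ∀ n, t ≤ r.time n → q ≠ ℓ g → (r.vars n q).status = .follower (ℓ g)
  unique : ∀ g p n, p ∈ S.members g → r.Correct p → t ≤ r.time n →
    (r.vars n p).status = .leader → p = ℓ g
  curLeader : ∀ g p n, r.Correct p → t ≤ r.time n → (r.vars n p).curLeader g = ℓ g

/-- The leader's delivery condition: `m` is committed and not yet delivered, and every message
with a local but no global timestamp has a local timestamp above the global timestamp of `m`. -/
def Deliverable [LinearOrder G] (r : Run P G M Pkt) (n : ℕ) (p : P) (m : M) : Prop :=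
  (r.vars n p).phase m = .committed ∧ (∀ k < n, ¬ r.Occurs k p (.deliver m)) ∧
    ∀ m'', ((r.vars n p).phase m'').Pending → (r.vars n p).globalTS m < (r.vars n p).localTS m''

open scoped Classical in
/-- The effect of the `n`-th event `e`, at a leader of the group `g`, on its variables `v`.
A proposal increments the clock and takes the result as local timestamp; a commit takes the
maximum of the local timestamps `Lts h` that `m` got in its destination groups `h` as global
timestamp, and makes sure that the clock is not below it. The clock may be increased at any time,
and the guess `curLeader` of the leaders may change at any time. -/
def LeaderEffect [LinearOrder G] (S : System P G M) (r : Run P G M Pkt) (n : ℕ) (g : G)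
    (e : Event P M Pkt) (v v' : Vars P G M) : Prop :=
  match e with
  | .propose m =>
      v.phase m = .start ∧
      v' = { v with
        clock := v.clock + 1
        phase := Function.update v.phase m .proposed
        localTS := Function.update v.localTS m (toLex (v.clock + 1, g))
        curLeader := v'.curLeader }
  | .accept m =>
      (v.phase m).Pending ∧ v.clock ≤ v'.clock ∧
      v' = { v with
        clock := v'.clock
        phase := Function.update v.phase m .accepted
        curLeader := v'.curLeader }
  | .commit m =>
      (v.phase m).Pending ∧
      ∃ (Lts : G → Timestamp G) (gts : Timestamp G),
        Lts g = v.localTS m ∧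
        (∀ h ∈ S.dest m, ∃ k ≤ n, ∃ q ∈ S.members h,
          (r.vars k q).phase m ≠ .start ∧ (r.vars k q).localTS m = Lts h) ∧
        IsGreatest (Lts '' (S.dest m : Set G)) gts ∧
        v.clock ≤ v'.clock ∧ tsTime gts ≤ v'.clock ∧
        v' = { v with
          clock := v'.clock
          phase := Function.update v.phase m .committed
          globalTS := Function.update v.globalTS m gts
          curLeader := v'.curLeader }
  | _ =>
      v.clock ≤ v'.clock ∧
      v' = { v with clock := v'.clock, curLeader := v'.curLeader }

/-- A run that follows Skeen's rules, with the timestamping and delivery decisions of every group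
taken by its leader. Nothing is said about how protocol messages are exchanged, nor about what
happens to the variables of a process that is not a leader or that gains or loses leadership
(state transfer during recovery), except that a message is never handled out of the blue. -/
structure FollowsSkeen [LinearOrder G] (S : System P G M) (r : Run P G M Pkt) : Prop where
  /-- a process handles only messages that have been multicast, to its group -/
  handle : ∀ n p m, (r.vars n p).phase m = .start → (r.vars (n + 1) p).phase m ≠ .start →
    (∃ k q, k < n ∧ r.Occurs k q (.multicast m)) ∧ ∃ g ∈ S.dest m, p ∈ S.members g
  leader_step : ∀ n p e g, r.Occurs n p e → p ∈ S.members g →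
    (r.vars n p).status = .leader → (r.vars (n + 1) p).status = .leader →
    r.LeaderEffect S n g e (r.vars n p) (r.vars (n + 1) p)
  /-- a leader delivers only deliverable messages, in the order of their global timestamps -/
  leader_deliver : ∀ n p m g, r.Occurs n p (.deliver m) → p ∈ S.members g →
    (r.vars n p).status = .leader →
    r.Deliverable n p m ∧
      ∀ m', r.Deliverable n p m' → (r.vars n p).globalTS m ≤ (r.vars n p).globalTS m'
  /-- local steps are instantaneous: a message that has become deliverable at a leader is
  delivered at the same time, unless the leader crashes or loses leadership at that time -/
  leader_instantaneous : ∀ n p m g, p ∈ S.members g → (∀ k ≤ n, ¬ r.Occurs k p .crash) →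
    (r.vars (n + 1) p).status = .leader → r.Deliverable (n + 1) p m →
    ∃ k > n, r.time k = r.time n ∧
      (r.Occurs k p (.deliver m) ∨ r.Occurs k p .crash ∨
        (r.vars (k + 1) p).status ≠ .leader)
  /-- the other members of a group deliver what a leader of the group decided to deliver -/
  follower_deliver : ∀ n q m g, r.Occurs n q (.deliver m) → q ∈ S.members g →
    (r.vars n q).status ≠ .leader →
    ∃ k < n, ∃ p ∈ S.members g, r.Occurs k p (.deliver m) ∧ (r.vars k p).status = .leader

/-- The event `e` occurs at process `p` at time `s`. -/
def OccursAt (r : Run P G M Pkt) (p : P) (e : Event P M Pkt) (s : ℝ) : Prop :=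
  ∃ n, r.Occurs n p e ∧ r.time n = s

end Run

/-! ### Protocols and their latencies. A protocol is given by the set of its runs. -/

/-- Messages are processed independently of each other until they are committed: when some of the
messages multicast after stabilisation are erased from a run (those outside `X`), there is a run
of the protocol without them, in which the remaining ones are multicast and committed by the
leaders at the same times. -/
def ProcessesIndependently (S : System P G M) (A : Set (Run P G M Pkt)) : Prop :=
  ∀ r ∈ A, ∀ t ℓ, r.StableFrom S t ℓ → ∀ X : Set M, ∃ r' ∈ A,
    r'.gst = r.gst ∧ (∀ p, r'.Correct p ↔ r.Correct p) ∧ r'.StableFrom S t ℓ ∧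
    (∀ p m s, r'.OccursAt p (.multicast m) s ↔
      r.OccursAt p (.multicast m) s ∧ (s ≤ t ∨ m ∈ X)) ∧
    (∀ p m s, m ∈ X → t < s → r.OccursAt p (.multicast m) s → ∀ g ∈ S.dest m, ∀ u,
      r'.OccursAt (ℓ g) (.commit m) u ↔ r.OccursAt (ℓ g) (.commit m) u)

/-- The Skeen-based atomic multicast implementations, in a system with message delay bound `δ`. -/
structure SkeenBasedMulticast [LinearOrder G] (S : System P G M) (δ : ℝ≥0)
    (A : Set (Run P G M Pkt)) : Prop where
  admissible : ∀ r ∈ A, r.Admissible S δ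
  atomicMulticast : ∀ r ∈ A, r.AtomicMulticastSpec S
  followsSkeen : ∀ r ∈ A, r.FollowsSkeen S
  /-- every run eventually has stable leaders (leader selection) -/
  stabilises : ∀ r ∈ A, ∃ t ℓ, r.StableFrom S t ℓ
  independent : ProcessesIndependently S A

/-- `Δ` bounds the time from multicasting a message, after a time `t` from which on the leaders are
stable, to its being committed by the leader of any of its destination groups. -/
def HasCommitLatency (S : System P G M) (A : Set (Run P G M Pkt)) (Δ : ℝ≥0) : Prop :=
  ∀ r ∈ A, ∃ t ℓ, r.StableFrom S t ℓ ∧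
    ∀ k p m, r.Occurs k p (.multicast m) → t < r.time k → ∀ g ∈ S.dest m,
      ∃ n, r.Occurs n (ℓ g) (.commit m) ∧ r.time n ≤ r.time k + Δ

/-- In every run there is a time `t ≥ GST` such that every collision-free message multicast after
`t` has a delivery latency of at most `Δ` with respect to all its destination groups, where the
delivery latency is the time to the first delivery in the group. -/
def HasCollisionFreeLatency (S : System P G M) (A : Set (Run P G M Pkt)) (Δ : ℝ≥0) : Prop :=
  ∀ r ∈ A, ∃ t, r.gst ≤ t ∧
    ∀ k p m, r.Occurs k p (.multicast m) → t < r.time k → r.CollisionFree S m →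
      ∀ g ∈ S.dest m, ∃ n, ∃ q ∈ S.members g,
        r.Occurs n q (.deliver m) ∧ r.time n ≤ r.time k + Δ

/-- The commit latency: the worst-case commit time, as the least bound (`⊤` if there is none). -/
noncomputable def commitLatency (S : System P G M) (A : Set (Run P G M Pkt)) : ℝ≥0∞ :=
  ⨅ (Δ : ℝ≥0) (_ : HasCommitLatency S A Δ), (Δ : ℝ≥0∞)

/-- The collision-free latency: the least bound (`⊤` if there is none). -/
noncomputable def collisionFreeLatency (S : System P G M) (A : Set (Run P G M Pkt)) : ℝ≥0∞ :=
  ⨅ (Δ : ℝ≥0) (_ : HasCollisionFreeLatency S A Δ), (Δ : ℝ≥0∞)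

end AtomicMulticast

/-!
Both directions rest on what the leader `ℓ g` of a group does once the run is stable. Its phases
only advance, so a message with a local timestamp keeps it, a committed message keeps its global
timestamp, and a message can reach the phase `committed` only by a commit event
(`phase_eq_committed_succ`, `phase_ne_start_of_le`, `exists_commit_of_committed`). A message that is
multicast after stabilisation is delivered in `g` by `ℓ g` first (`leader_delivers_first`), hence it
is committed there no later than it is delivered in the group.

The central fact is `delivered_or_blocked`: for all messages `m` multicast late enough, `ℓ g`
delivers `m` at the very time at which it commits `m`, unless another message that was multicast
after stabilisation is pending at `ℓ g` at that time. Only finitely many messages are multicast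
before stabilisation, and each of them eventually stops being pending or stays pending forever; in
the latter case it never blocks a late message `m`, for `m` would then never be delivered,
contrary to Termination.

*A commit bound is a collision-free bound.* Let `m` be late and collision-free. A message that
blocks `m` when it is committed conflicts with `m` and was multicast by a correct process, so by
collision-freedom one of the two was partially delivered before the other one was multicast. If it
is `m`, then `m` has been delivered in time; if it is the blocking message, then that message is
already committed at the leader and does not block.

*A collision-free bound is a commit bound.* Suppose that in some run arbitrarily late messages
violate the bound `D` on the commit time. Choose a sequence of them in which every message is
multicast only after its predecessor has been committed in all its destination groups, and erase
all other messages multicast after stabilisation. In the resulting run the chosen messages are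
committed at the same times, so they do not block each other and, by `delivered_or_blocked`, all but
finitely many are delivered when they are committed, before the next one is multicast. The messages
multicast by correct processes up to some fixed time are eventually partially delivered. Hence the
late messages of the sequence are collision-free, are delivered within time `D`, and so were
committed within time `D`, in the new run and therefore also in the original one.
-/

namespace AtomicMulticast

namespace Run

variable {P G M Pkt : Type*} {S : System P G M} {δ : ℝ≥0} {r : Run P G M Pkt}
  {t : ℝ} {ℓ : G → P}

/-! ### Consequences of the system model -/

theorem StableFrom.mono (h : r.StableFrom S t ℓ) {t' : ℝ} (htt' : t ≤ t') :
    r.StableFrom S t' ℓ where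
  gst_le := h.gst_le.trans htt'
  leader g n hn := h.leader g n (htt'.trans hn)
  quorum g := by
    obtain ⟨Q, hQ, hc, hl, h1⟩ := h.quorum g
    exact ⟨Q, hQ, hc, hl, fun q hq => ⟨(h1 q hq).1, fun n hn => (h1 q hq).2 n (htt'.trans hn)⟩⟩
  unique g p n hp hc hn := h.unique g p n hp hc (htt'.trans hn)
  curLeader g p n hc hn := h.curLeader g p n hc (htt'.trans hn)

theorem StableFrom.leader_mem (h : r.StableFrom S t ℓ) (g : G) : ℓ g ∈ S.members g := by
  obtain ⟨Q, hQ, -, hl, -⟩ := h.quorum g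
  exact hQ hl

theorem StableFrom.leader_correct (h : r.StableFrom S t ℓ) (g : G) : r.Correct (ℓ g) := by
  obtain ⟨Q, -, -, hl, h1⟩ := h.quorum g
  exact (h1 _ hl).1

theorem Occurs.eq_of_multicast (hr : r.Admissible S δ) {n k : ℕ} {p q : P} {m : M}
    (h : r.Occurs n p (.multicast m)) (h' : r.Occurs k q (.multicast m)) : n = k :=
  hr.multicast_unique n k p q m h h'

theorem index_lt_of_time_lt (hr : r.Admissible S δ) {n k : ℕ} (h : r.time n < r.time k) :
    n < k := by
  by_contra hk
  exact absurd (hr.time_mono (not_lt.1 hk)) (not_le.2 h)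

/-- Crashed processes take no steps, and there are no crashes after the global stabilisation
time. -/
theorem correct_of_occurs (hr : r.Admissible S δ) {n : ℕ} {p : P} {e : Event P M Pkt}
    (h : r.Occurs n p e) (hn : r.gst < r.time n) : r.Correct p := fun k hk =>
  hr.crash_stop k n p e hk (index_lt_of_time_lt hr ((hr.crash_le_gst k p hk).trans_lt hn)) h

theorem multicast_of_phase_ne_start [LinearOrder G] (hr : r.Admissible S δ)
    (hs : r.FollowsSkeen S) {n : ℕ} {p : P} {m : M} (h : (r.vars n p).phase m ≠ .start) :
    (∃ k q, k < n ∧ r.Occurs k q (.multicast m)) ∧ ∃ g ∈ S.dest m, p ∈ S.members g := by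
  induction n with
  | zero => exact absurd ((hr.init p).2 m) h
  | succ n ih =>
    by_cases h0 : (r.vars n p).phase m = .start
    · obtain ⟨⟨k, q, hk, hq⟩, hg⟩ := hs.handle n p m h0 h
      exact ⟨⟨k, q, by omega, hq⟩, hg⟩
    · obtain ⟨⟨k, q, hk, hq⟩, hg⟩ := ih h0
      exact ⟨⟨k, q, by omega, hq⟩, hg⟩

/-- Since groups are disjoint, a member of `g` handles only messages addressed to `g`. -/
theorem mem_dest_of_phase_ne_start [LinearOrder G] (hr : r.Admissible S δ)
    (hs : r.FollowsSkeen S) {n : ℕ} {p : P} {m : M} {g : G} (hp : p ∈ S.members g)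
    (h : (r.vars n p).phase m ≠ .start) : g ∈ S.dest m := by
  obtain ⟨-, g', hg', hp'⟩ := multicast_of_phase_ne_start hr hs h
  by_cases hgg : g = g'
  · rwa [hgg]
  · exact absurd hp' (Finset.disjoint_left.1 (S.disjoint g g' hgg) hp)

theorem eventually_atTop_of_time_le (hr : r.Admissible S δ) (T : ℝ) {Q : ℕ → ℕ → Prop}
    (h : ∀ k, r.time k ≤ T → ∀ᶠ n in atTop, Q k n) :
    ∀ᶠ n in atTop, ∀ k, r.time k ≤ T → Q k n := by
  obtain ⟨N, hN⟩ := eventually_atTop.1 (hr.time_diverges.eventually_gt_atTop T)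
  have h' : ∀ᶠ n in atTop, ∀ k ∈ Finset.range N, r.time k ≤ T → Q k n := by
    rw [eventually_all_finset]
    intro k _
    by_cases hk : r.time k ≤ T
    · filter_upwards [h k hk] with n hn _ using hn
    · exact .of_forall fun n hk' => absurd hk' hk
  filter_upwards [h'] with n hn k hk
  refine hn k (Finset.mem_range.2 ?_) hk
  by_contra hkN
  exact absurd (hN k (not_lt.1 hkN)) (not_lt.2 hk)

/-- A message multicast by a correct process is eventually partially delivered, and there are only
finitely many events up to a given time. -/
theorem eventually_partiallyDelivered (hr : r.Admissible S δ)
    (ha : r.AtomicMulticastSpec S) (T : ℝ) :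
    ∀ᶠ n in atTop, ∀ k, r.time k ≤ T → ∀ p m, r.Correct p → r.Occurs k p (.multicast m) →
      r.PartiallyDeliveredBefore S m n := by
  refine eventually_atTop_of_time_le hr T fun k _ => ?_
  by_cases h : ∃ p m, r.Correct p ∧ r.Occurs k p (.multicast m)
  · obtain ⟨p, m, hp, h⟩ := h
    have hdel : ∀ᶠ n in atTop, ∀ g ∈ S.dest m, ∃ k < n, ∃ q ∈ S.members g,
        r.Occurs k q (.deliver m) := by
      rw [eventually_all_finset]
      intro g hg
      obtain ⟨Q, hQ, hc, hd⟩ := ha.termination m (.inl ⟨k, p, hp, h⟩) g hg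
      obtain ⟨q, hq⟩ : Q.Nonempty := Finset.card_pos.1 (by omega)
      obtain ⟨j, hj⟩ := hd q hq
      filter_upwards [eventually_gt_atTop j] with n hn using ⟨j, hn, q, hQ hq, hj⟩
    filter_upwards [hdel] with n hn p' m' _ h'
    simp only [Occurs] at h h'
    rw [h] at h'
    simp only [Option.some.injEq, Prod.mk.injEq, Event.multicast.injEq] at h'
    rw [← h'.2]
    exact hn
  · exact .of_forall fun n p m hp hm => absurd ⟨p, m, hp, hm⟩ h

/-- A commit event that precedes stabilisation is subject to no rule, and might even precede the
multicast of its message; this concerns finitely many messages only. -/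
theorem eventually_commit_after (hr : r.Admissible S δ) (t : ℝ) :
    ∀ᶠ k in atTop, ∀ n, r.time n ≤ t → ∀ p q m, r.Occurs k p (.multicast m) →
      ¬ r.Occurs n q (.commit m) := by
  refine eventually_atTop_of_time_le hr t fun n _ => ?_
  by_cases h : ∃ k p q m, r.Occurs k p (.multicast m) ∧ r.Occurs n q (.commit m)
  · obtain ⟨k, p, q, m, hk, hn⟩ := h
    filter_upwards [eventually_gt_atTop k] with k' hk' p' q' m' hm' hn'
    simp only [Occurs] at hn hn'
    rw [hn] at hn'
    simp only [Option.some.injEq, Prod.mk.injEq, Event.commit.injEq] at hn'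
    rw [← hn'.2] at hm'
    exact hk'.ne (Occurs.eq_of_multicast hr hk hm')
  · exact .of_forall fun k p q m hk hn => h ⟨k, p, q, m, hk, hn⟩

/-! ### Steps of a stable leader -/

section Leader

variable [LinearOrder G]

theorem step_of_stable (hr : r.Admissible S δ) (hs : r.FollowsSkeen S)
    (hst : r.StableFrom S t ℓ) (g : G) {n : ℕ} (hn : t ≤ r.time n) :
    r.vars (n + 1) (ℓ g) = r.vars n (ℓ g) ∨ ∃ e, r.Occurs n (ℓ g) e ∧
      r.LeaderEffect S n g e (r.vars n (ℓ g)) (r.vars (n + 1) (ℓ g)) := by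
  by_cases h : ∃ e, r.Occurs n (ℓ g) e
  · obtain ⟨e, he⟩ := h
    exact .inr ⟨e, he, hs.leader_step n _ e g he (hst.leader_mem g) (hst.leader g n hn)
      (hst.leader g _ (hn.trans (hr.time_mono n.le_succ)))⟩
  · exact .inl (hr.frame n _ (not_exists.1 h))

theorem commit_of_stable (hr : r.Admissible S δ) (hs : r.FollowsSkeen S)
    (hst : r.StableFrom S t ℓ) {g : G} {n : ℕ} {m : M} (hn : t ≤ r.time n)
    (h : r.Occurs n (ℓ g) (.commit m)) :
    ((r.vars n (ℓ g)).phase m).Pending ∧ (r.vars (n + 1) (ℓ g)).phase m = .committed := by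
  obtain ⟨hp, Lts, gts, -, -, -, -, -, h'⟩ := hs.leader_step n _ _ g h (hst.leader_mem g)
    (hst.leader g n hn) (hst.leader g _ (hn.trans (hr.time_mono n.le_succ)))
  exact ⟨hp, by rw [h']; simp⟩

theorem phase_eq_committed_succ (hr : r.Admissible S δ) (hs : r.FollowsSkeen S)
    (hst : r.StableFrom S t ℓ) {g : G} {n : ℕ} {m : M} (hn : t ≤ r.time n)
    (h : (r.vars n (ℓ g)).phase m = .committed) :
    (r.vars (n + 1) (ℓ g)).phase m = .committed ∧
      (r.vars (n + 1) (ℓ g)).globalTS m = (r.vars n (ℓ g)).globalTS m := by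
  rcases step_of_stable hr hs hst g hn with h' | ⟨e, -, h'⟩
  · rw [h']; exact ⟨h, rfl⟩
  have hne : ∀ m', (r.vars n (ℓ g)).phase m' ≠ .committed → m ≠ m' := by
    rintro m' hm' rfl
    exact hm' h
  cases e with
  | propose m' =>
    obtain ⟨h1, h2⟩ := h'
    have := hne m' (by simp [h1])
    rw [h2]; simp [this, h]
  | accept m' =>
    obtain ⟨h1, -, h2⟩ := h'
    have := hne m' (by rcases h1 with h1 | h1 <;> simp [h1])
    rw [h2]; simp [this, h]
  | commit m' =>
    obtain ⟨h1, Lts, gts, -, -, -, -, -, h2⟩ := h'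
    have := hne m' (by rcases h1 with h1 | h1 <;> simp [h1])
    rw [h2]; simp [this, h]
  | _ => obtain ⟨-, h2⟩ := h'; rw [h2]; exact ⟨h, rfl⟩

theorem phase_ne_start_succ (hr : r.Admissible S δ) (hs : r.FollowsSkeen S)
    (hst : r.StableFrom S t ℓ) {g : G} {n : ℕ} {m : M} (hn : t ≤ r.time n)
    (h : (r.vars n (ℓ g)).phase m ≠ .start) :
    (r.vars (n + 1) (ℓ g)).phase m ≠ .start ∧
      (r.vars (n + 1) (ℓ g)).localTS m = (r.vars n (ℓ g)).localTS m := by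
  rcases step_of_stable hr hs hst g hn with h' | ⟨e, -, h'⟩
  · rw [h']; exact ⟨h, rfl⟩
  cases e with
  | propose m' =>
    obtain ⟨h1, h2⟩ := h'
    have : m ≠ m' := by rintro rfl; exact h h1
    rw [h2]; simp [this, h]
  | accept m' =>
    obtain ⟨-, -, h2⟩ := h'
    rw [h2]
    by_cases hm : m = m'
    · subst hm; simp
    · simp [hm, h]
  | commit m' =>
    obtain ⟨-, Lts, gts, -, -, -, -, -, h2⟩ := h'
    rw [h2]
    by_cases hm : m = m'
    · subst hm; simp
    · simp [hm, h]
  | _ => obtain ⟨-, h2⟩ := h'; rw [h2]; exact ⟨h, rfl⟩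

theorem occurs_commit_of_phase_succ (hr : r.Admissible S δ) (hs : r.FollowsSkeen S)
    (hst : r.StableFrom S t ℓ) {g : G} {n : ℕ} {m : M} (hn : t ≤ r.time n)
    (h : (r.vars n (ℓ g)).phase m ≠ .committed)
    (h1 : (r.vars (n + 1) (ℓ g)).phase m = .committed) : r.Occurs n (ℓ g) (.commit m) := by
  rcases step_of_stable hr hs hst g hn with h' | ⟨e, he, h'⟩
  · exact absurd (h' ▸ h1) h
  cases e with
  | propose m' =>
    obtain ⟨-, h2⟩ := h'
    rw [h2] at h1
    by_cases hm : m = m'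
    · subst hm; simp at h1
    · simp [hm, h] at h1
  | accept m' =>
    obtain ⟨-, -, h2⟩ := h'
    rw [h2] at h1
    by_cases hm : m = m'
    · subst hm; simp at h1
    · simp [hm, h] at h1
  | commit m' =>
    obtain ⟨-, Lts, gts, -, -, -, -, -, h2⟩ := h'
    rw [h2] at h1
    by_cases hm : m = m'
    · exact hm ▸ he
    · simp [hm, h] at h1
  | _ => obtain ⟨-, h2⟩ := h'; rw [h2] at h1; exact absurd h1 h

theorem phase_eq_committed_of_le (hr : r.Admissible S δ) (hs : r.FollowsSkeen S)
    (hst : r.StableFrom S t ℓ) {g : G} {n j : ℕ} {m : M} (hn : t ≤ r.time n) (hnj : n ≤ j)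
    (h : (r.vars n (ℓ g)).phase m = .committed) :
    (r.vars j (ℓ g)).phase m = .committed ∧
      (r.vars j (ℓ g)).globalTS m = (r.vars n (ℓ g)).globalTS m := by
  induction j, hnj using Nat.le_induction with
  | base => exact ⟨h, rfl⟩
  | succ j hj ih =>
    have := phase_eq_committed_succ hr hs hst (hn.trans (hr.time_mono hj)) ih.1
    exact ⟨this.1, this.2.trans ih.2⟩

theorem phase_ne_start_of_le (hr : r.Admissible S δ) (hs : r.FollowsSkeen S)
    (hst : r.StableFrom S t ℓ) {g : G} {n j : ℕ} {m : M} (hn : t ≤ r.time n) (hnj : n ≤ j)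
    (h : (r.vars n (ℓ g)).phase m ≠ .start) :
    (r.vars j (ℓ g)).phase m ≠ .start ∧
      (r.vars j (ℓ g)).localTS m = (r.vars n (ℓ g)).localTS m := by
  induction j, hnj using Nat.le_induction with
  | base => exact ⟨h, rfl⟩
  | succ j hj ih =>
    have := phase_ne_start_succ hr hs hst (hn.trans (hr.time_mono hj)) ih.1
    exact ⟨this.1, this.2.trans ih.2⟩

theorem exists_commit_of_committed (hr : r.Admissible S δ) (hs : r.FollowsSkeen S)
    (hst : r.StableFrom S t ℓ) {g : G} {n j : ℕ} {m : M} (hn : t ≤ r.time n) (hnj : n ≤ j)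
    (h : (r.vars n (ℓ g)).phase m ≠ .committed) (hj : (r.vars j (ℓ g)).phase m = .committed) :
    ∃ i, n ≤ i ∧ i < j ∧ r.Occurs i (ℓ g) (.commit m) := by
  induction j, hnj using Nat.le_induction with
  | base => exact absurd hj h
  | succ j hnj ih =>
    by_cases h1 : (r.vars j (ℓ g)).phase m = .committed
    · obtain ⟨i, hi, hij, hc⟩ := ih h1
      exact ⟨i, hi, by omega, hc⟩
    · exact ⟨j, hnj, by omega,
        occurs_commit_of_phase_succ hr hs hst (hn.trans (hr.time_mono hnj)) h1 hj⟩

theorem _root_.AtomicMulticast.Phase.pending_iff (φ : Phase) :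
    φ.Pending ↔ φ ≠ .start ∧ φ ≠ .committed := by
  cases φ <;> simp [Phase.Pending]

theorem eventually_pending_forever (hr : r.Admissible S δ) (hs : r.FollowsSkeen S)
    (hst : r.StableFrom S t ℓ) (g : G) (m : M) :
    ∀ᶠ n in atTop, ((r.vars n (ℓ g)).phase m).Pending →
      ∀ j ≥ n, ((r.vars j (ℓ g)).phase m).Pending := by
  by_cases h : ∃ n, t ≤ r.time n ∧ (r.vars n (ℓ g)).phase m = .committed
  · obtain ⟨n, hn, h⟩ := h
    filter_upwards [eventually_ge_atTop n] with k hk hp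
    exact absurd (phase_eq_committed_of_le hr hs hst hn hk h).1 ((Phase.pending_iff _).1 hp).2
  · push Not at h
    filter_upwards [hr.time_diverges.eventually_ge_atTop t] with n hn hp j hj
    exact (Phase.pending_iff _).2
      ⟨(phase_ne_start_of_le hr hs hst hn hj ((Phase.pending_iff _).1 hp).1).1,
        h j (hn.trans (hr.time_mono hj))⟩

/-! ### Delivery at a stable leader -/

/-- Followers deliver only what a leader has delivered, and after stabilisation the only leader
of `g` is `ℓ g`. -/
theorem leader_delivers_first (hr : r.Admissible S δ) (hs : r.FollowsSkeen S)
    (ha : r.AtomicMulticastSpec S) (hst : r.StableFrom S t ℓ) {k n : ℕ} {p q : P} {m : M} {g : G}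
    (hk : r.Occurs k p (.multicast m)) (ht : t < r.time k) (hn : r.Occurs n q (.deliver m))
    (hq : q ∈ S.members g) :
    ∃ j ≤ n, k < j ∧ r.Occurs j (ℓ g) (.deliver m) ∧ r.Deliverable j (ℓ g) m := by
  -- only a correct process can deliver `m`, since `m` is multicast after stabilisation
  have key : ∀ j q', r.Occurs j q' (.deliver m) → q' ∈ S.members g →
      (r.vars j q').status = .leader →
      k < j ∧ r.Occurs j (ℓ g) (.deliver m) ∧ r.Deliverable j (ℓ g) m := by
    intro j q' hj hq' hl
    obtain ⟨⟨k', p', hk', hp'⟩, -⟩ := ha.validity j q' m g hj hq'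
    obtain rfl := hk.eq_of_multicast hr hp'
    have htj : t < r.time j := ht.trans_le (hr.time_mono hk'.le)
    obtain rfl := hst.unique g q' j hq' (correct_of_occurs hr hj (hst.gst_le.trans_lt htj)) htj.le hl
    exact ⟨hk', hj, (hs.leader_deliver j _ m g hj hq' hl).1⟩
  by_cases hl : (r.vars n q).status = .leader
  · exact ⟨n, le_rfl, key n q hn hq hl⟩
  · obtain ⟨j, hj, q', hq', hd, hl'⟩ := hs.follower_deliver n q m g hn hq hl
    exact ⟨j, hj.le, key j q' hd hq' hl'⟩

theorem leader_delivers (hr : r.Admissible S δ) (hs : r.FollowsSkeen S)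
    (ha : r.AtomicMulticastSpec S) (hst : r.StableFrom S t ℓ) {k : ℕ} {p : P} {m : M} {g : G}
    (hk : r.Occurs k p (.multicast m)) (ht : t < r.time k) (hg : g ∈ S.dest m) :
    ∃ j, k < j ∧ r.Occurs j (ℓ g) (.deliver m) ∧ r.Deliverable j (ℓ g) m := by
  obtain ⟨Q, hQ, hc, hd⟩ := ha.termination m
    (.inl ⟨k, p, correct_of_occurs hr hk (hst.gst_le.trans_lt ht), hk⟩) g hg
  obtain ⟨q, hq⟩ : Q.Nonempty := Finset.card_pos.1 (by omega)
  obtain ⟨n, hn⟩ := hd q hq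
  obtain ⟨j, -, h⟩ := leader_delivers_first hr hs ha hst hk ht hn (hQ hq)
  exact ⟨j, h⟩

theorem exists_commit_of_deliverable (hr : r.Admissible S δ) (hs : r.FollowsSkeen S)
    (hst : r.StableFrom S t ℓ) {k j : ℕ} {p : P} {m : M} {g : G}
    (hk : r.Occurs k p (.multicast m)) (ht : t < r.time k) (hkj : k < j)
    (hj : r.Deliverable j (ℓ g) m) : ∃ i, k ≤ i ∧ i < j ∧ r.Occurs i (ℓ g) (.commit m) := by
  refine exists_commit_of_committed hr hs hst ht.le hkj.le (fun h => ?_) hj.1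
  obtain ⟨⟨k', p', hk', hp'⟩, -⟩ := multicast_of_phase_ne_start (n := k) (p := ℓ g) (m := m) hr hs
    (by simp [h])
  exact hk'.ne (hp'.eq_of_multicast hr hk)

theorem multicast_lt_commit (hr : r.Admissible S δ) (hs : r.FollowsSkeen S)
    (hst : r.StableFrom S t ℓ) {k n : ℕ} {p : P} {m : M} {g : G}
    (hk : r.Occurs k p (.multicast m)) (ht : t ≤ r.time n)
    (hn : r.Occurs n (ℓ g) (.commit m)) : k < n := by
  obtain ⟨⟨k', p', hk', hp'⟩, -⟩ := multicast_of_phase_ne_start hr hs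
    ((Phase.pending_iff _).1 (commit_of_stable hr hs hst ht hn).1).1
  rwa [hk.eq_of_multicast hr hp']

/-- A message multicast late enough is delivered by the leader when it commits the message, unless
another message multicast after stabilisation blocks it. -/
theorem delivered_or_blocked [Finite G] (hr : r.Admissible S δ) (hs : r.FollowsSkeen S)
    (ha : r.AtomicMulticastSpec S) (hst : r.StableFrom S t ℓ) :
    ∃ T ≥ t, ∀ k p m, r.Occurs k p (.multicast m) → T < r.time k → ∀ g ∈ S.dest m, ∀ n,
      t ≤ r.time n → r.Occurs n (ℓ g) (.commit m) →
        (∃ j, r.Occurs j (ℓ g) (.deliver m) ∧ r.time j ≤ r.time n) ∨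
        ∃ k' p' m', m' ≠ m ∧ r.Occurs k' p' (.multicast m') ∧ t < r.time k' ∧ k' ≤ n ∧
          g ∈ S.dest m' ∧ ((r.vars (n + 1) (ℓ g)).phase m').Pending := by
  -- the messages multicast up to time `t` settle: no longer pending, or pending forever
  have hsettle : ∀ᶠ n in atTop, ∀ k, r.time k ≤ t → ∀ g p m, r.Occurs k p (.multicast m) →
      ((r.vars n (ℓ g)).phase m).Pending → ∀ j ≥ n, ((r.vars j (ℓ g)).phase m).Pending := by
    refine eventually_atTop_of_time_le hr t fun k _ => eventually_all.2 fun g => ?_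
    by_cases h : ∃ p m, r.Occurs k p (.multicast m)
    · obtain ⟨p, m, h⟩ := h
      filter_upwards [eventually_pending_forever hr hs hst g m] with n hn p' m' h'
      simp only [Occurs] at h h'
      rw [h] at h'
      simp only [Option.some.injEq, Prod.mk.injEq, Event.multicast.injEq] at h'
      rw [← h'.2]
      exact hn
    · exact .of_forall fun n p m hp => absurd ⟨p, m, hp⟩ h
  obtain ⟨N, hN⟩ := eventually_atTop.1 hsettle
  refine ⟨max t (r.time N), le_max_left _ _, fun k p m hk hT g hg n htn hn => ?_⟩
  have htk : t < r.time k := (le_max_left _ _).trans_lt hT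
  have hNk : N < k := index_lt_of_time_lt hr ((le_max_right _ _).trans_lt hT)
  have hkn : k < n := multicast_lt_commit hr hs hst hk htn hn
  have hcomm := (commit_of_stable hr hs hst htn hn).2
  have htn1 : t ≤ r.time (n + 1) := htn.trans (hr.time_mono n.le_succ)
  refine or_iff_not_imp_left.2 fun hnd => ?_
  have hnd' : ∀ j < n + 1, ¬ r.Occurs j (ℓ g) (.deliver m) := fun j hj hd =>
    hnd ⟨j, hd, hr.time_mono (by omega)⟩
  -- `m` is not deliverable, for it would be delivered at once
  have hblock : ¬ r.Deliverable (n + 1) (ℓ g) m := fun hdel => by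
    obtain ⟨j, hj, htj, hd | hd | hd⟩ := hs.leader_instantaneous n (ℓ g) m g (hst.leader_mem g)
      (fun i _ => hst.leader_correct g i) (hst.leader g _ htn1) hdel
    · exact hnd ⟨j, hd, htj.le⟩
    · exact hst.leader_correct g j hd
    · exact hd (hst.leader g _ (htn.trans (hr.time_mono (by omega))))
  obtain ⟨m', hp', hle⟩ : ∃ m', ((r.vars (n + 1) (ℓ g)).phase m').Pending ∧
      (r.vars (n + 1) (ℓ g)).localTS m' ≤ (r.vars (n + 1) (ℓ g)).globalTS m := by
    by_contra hcon
    push Not at hcon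
    exact hblock ⟨hcomm, hnd', hcon⟩
  have hpm' := (Phase.pending_iff _).1 hp'
  obtain ⟨⟨k', q, hk', hq⟩, -⟩ := multicast_of_phase_ne_start hr hs hpm'.1
  refine ⟨k', q, m', ?_, hq, ?_, by omega,
    mem_dest_of_phase_ne_start hr hs (hst.leader_mem g) hpm'.1, hp'⟩
  · rintro rfl
    exact hpm'.2 hcomm
  · by_contra hold
    -- `m'` is pending forever and keeps its timestamp, so `m` is never delivered
    have hforever := hN (n + 1) (by omega) k' (not_lt.1 hold) g q m' hq hp'
    obtain ⟨j, -, hd, hdel⟩ := leader_delivers hr hs ha hst hk htk hg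
    have hj : n + 1 ≤ j := by
      by_contra hj
      exact hnd' j (by omega) hd
    have h1 := hdel.2.2 m' (hforever j hj)
    rw [(phase_eq_committed_of_le hr hs hst htn1 hj hcomm).2,
      (phase_ne_start_of_le hr hs hst htn1 hj hpm'.1).2] at h1
    exact absurd h1 (not_lt.2 hle)

end Leader

end Run

/-! ### Comparison of the two latencies -/

variable {P G M Pkt : Type*} [LinearOrder G] {S : System P G M} {δ : ℝ≥0}
  {A : Set (Run P G M Pkt)}

theorem HasCommitLatency.hasCollisionFreeLatency [Finite G] (hA : SkeenBasedMulticast S δ A)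
    {D : ℝ≥0} (h : HasCommitLatency S A D) : HasCollisionFreeLatency S A D := by
  intro r hrA
  have hr := hA.admissible r hrA
  have hs := hA.followsSkeen r hrA
  have ha := hA.atomicMulticast r hrA
  obtain ⟨t, ℓ, hst, hD⟩ := h r hrA
  obtain ⟨T, hTt, hT⟩ := Run.delivered_or_blocked hr hs ha hst
  obtain ⟨N, hN⟩ := eventually_atTop.1 (Run.eventually_commit_after hr t)
  refine ⟨max T (r.time N), hst.gst_le.trans (hTt.trans (le_max_left _ _)),
    fun k p m hk hkT hcf g hg => ?_⟩
  have hkT' : T < r.time k := (le_max_left _ _).trans_lt hkT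
  have hkt : t < r.time k := hTt.trans_lt hkT'
  have hNk : N < k := Run.index_lt_of_time_lt hr ((le_max_right _ _).trans_lt hkT)
  obtain ⟨n, hn, hnD⟩ := hD k p m hk hkt g hg
  have htn : t ≤ r.time n := by
    by_contra htn
    exact hN k hNk.le n (not_le.1 htn).le p _ m hk hn
  rcases hT k p m hk hkT' g hg n htn hn with ⟨j, hj, hjn⟩ |
    ⟨k', p', m', hne, hk', htk', hkn', hg', hpend⟩
  · exact ⟨j, ℓ g, hst.leader_mem g, hj, hjn.trans hnD⟩
  have hnc := hcf m' hne
    ⟨k', p', Run.correct_of_occurs hr hk' (hst.gst_le.trans_lt htk'), hk'⟩ ⟨g, hg, hg'⟩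
  by_cases hmd : r.PartiallyDeliveredBefore S m k'
  · obtain ⟨j, hj, q, hq, hd⟩ := hmd g hg
    exact ⟨j, q, hq, hd, (hr.time_mono (by omega)).trans hnD⟩
  by_cases hmd' : r.PartiallyDeliveredBefore S m' k
  · obtain ⟨j, hj, q, hq, hd⟩ := hmd' g hg'
    obtain ⟨i, hij, hki, -, hdel⟩ := Run.leader_delivers_first hr hs ha hst hk' htk' hd hq
    have hkn := Run.multicast_lt_commit hr hs hst hk htn hn
    exact absurd (Run.phase_eq_committed_of_le hr hs hst
      (htk'.le.trans (hr.time_mono hki.le)) (by omega) hdel.1).1 ((Phase.pending_iff _).1 hpend).2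
  · exact absurd ⟨k, p, k', p', hk, hk', hmd, hmd'⟩ hnc

theorem HasCollisionFreeLatency.hasCommitLatency [Finite G] (hA : SkeenBasedMulticast S δ A)
    {D : ℝ≥0} (h : HasCollisionFreeLatency S A D) : HasCommitLatency S A D := by
  intro r hrA
  have hr := hA.admissible r hrA
  have hs := hA.followsSkeen r hrA
  have ha := hA.atomicMulticast r hrA
  obtain ⟨t, ℓ, hst⟩ := hA.stabilises r hrA
  by_contra hcon
  -- arbitrarily late messages `m` are committed too late by some leader, and by the time `U` all
  -- leaders have committed `m`
  have hbad : ∀ T, ∃ (k : ℕ) (p : P) (m : M) (U : ℝ), r.Occurs k p (.multicast m) ∧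
      max t T < r.time k ∧
      (∃ g ∈ S.dest m, ∀ n, r.Occurs n (ℓ g) (.commit m) → r.time k + D < r.time n) ∧
      r.time k ≤ U ∧
      ∀ g ∈ S.dest m, ∃ n, k ≤ n ∧ r.Occurs n (ℓ g) (.commit m) ∧ r.time n ≤ U := by
    intro T
    by_contra hT
    refine hcon ⟨max t T, ℓ, hst.mono (le_max_left _ _), fun k p m hk htk g hg => ?_⟩
    by_contra hlate
    push Not at hlate
    have htk' : t < r.time k := (le_max_left _ _).trans_lt htk
    have hev : ∀ᶠ N in atTop, ∀ g ∈ S.dest m,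
        ∃ n, k ≤ n ∧ r.Occurs n (ℓ g) (.commit m) ∧ r.time n ≤ r.time N := by
      rw [eventually_all_finset]
      intro g hg
      obtain ⟨j, hkj, -, hdel⟩ := Run.leader_delivers hr hs ha hst hk htk' hg
      obtain ⟨i, hki, -, hi⟩ := Run.exists_commit_of_deliverable hr hs hst hk htk' hkj hdel
      filter_upwards [eventually_ge_atTop i] with N hN using ⟨i, hki, hi, hr.time_mono hN⟩
    obtain ⟨N, hN, hkN⟩ := (hev.and (eventually_ge_atTop k)).exists
    exact hT ⟨k, p, m, r.time N, hk, htk, ⟨g, hg, hlate⟩, hr.time_mono hkN, hN⟩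
  choose k p m U hk htk hlate hkU hU using hbad
  -- the `i`-th chosen message is `m (T i)`
  -- `T` is defined so that message `i + 1` is multicast after time `i` and after message `i` has
  -- been committed everywhere
  let T : ℕ → ℝ := fun i => Nat.rec 0 (fun i Ti => max (i : ℝ) (U Ti)) i
  have hTsucc : ∀ i, T (i + 1) = max (i : ℝ) (U (T i)) := fun i => rfl
  have htT : ∀ i, t < r.time (k (T i)) := fun i => (le_max_left _ _).trans_lt (htk _)
  have hsep : ∀ i j, i < j → U (T i) < r.time (k (T j)) := by
    intro i j hij
    induction j, Nat.succ_le_of_lt hij using Nat.le_induction with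
    | base =>
      exact ((le_max_right _ _).trans (hTsucc i).ge).trans_lt ((le_max_right _ _).trans_lt (htk _))
    | succ j hj ih =>
      exact (ih hj).trans_le ((hkU _).trans (((le_max_right _ _).trans (hTsucc j).ge).trans
        ((le_max_right _ _).trans (htk _).le)))
  have hlarge : ∀ B : ℝ, ∃ i, B < r.time (k (T i)) := by
    intro B
    obtain ⟨i, hi⟩ := exists_nat_gt B
    exact ⟨i + 1, hi.trans (((le_max_left _ _).trans (hTsucc i).ge).trans_lt
      ((le_max_right _ _).trans_lt (htk _)))⟩
  obtain ⟨r', hrA', -, -, hst', hmc, hcm⟩ :=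
    hA.independent r hrA t ℓ hst (Set.range fun i => m (T i))
  have hr' := hA.admissible r' hrA'
  have hs' := hA.followsSkeen r' hrA'
  have ha' := hA.atomicMulticast r' hrA'
  -- the chosen messages are multicast in the new run at the same times as in the given run
  have hmulti : ∀ i, ∃ k', r'.Occurs k' (p (T i)) (.multicast (m (T i))) ∧
      r'.time k' = r.time (k (T i)) := fun i =>
    (hmc _ _ _).2 ⟨⟨_, hk _, rfl⟩, .inr ⟨i, rfl⟩⟩
  choose k' hk' htk' using hmulti
  have hcommit : ∀ i, ∀ g ∈ S.dest (m (T i)), ∀ u,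
      r'.OccursAt (ℓ g) (.commit (m (T i))) u ↔ r.OccursAt (ℓ g) (.commit (m (T i))) u :=
    fun i => hcm (p (T i)) (m (T i)) _ ⟨i, rfl⟩ (htT i) ⟨_, hk _, rfl⟩
  have hcommit' : ∀ i, ∀ g ∈ S.dest (m (T i)), ∃ n, r'.Occurs n (ℓ g) (.commit (m (T i))) ∧
      t < r'.time n ∧ r'.time n ≤ U (T i) := by
    intro i g hg
    obtain ⟨n, hkn, hn, hnU⟩ := hU (T i) g hg
    obtain ⟨n', hn', htn'⟩ := (hcommit i g hg _).2 ⟨n, hn, rfl⟩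
    exact ⟨n', hn', htn' ▸ (htT i).trans_le (hr.time_mono hkn), htn' ▸ hnU⟩
  have hchosen : ∀ j q m', r'.Occurs j q (.multicast m') → t < r'.time j →
      ∃ i, m' = m (T i) ∧ j = k' i := by
    intro j q m' hj htj
    obtain ⟨-, hle | ⟨i, hi⟩⟩ := (hmc q m' _).1 ⟨j, hj, rfl⟩
    · exact absurd htj (not_lt.2 hle)
    · obtain rfl : m (T i) = m' := hi
      exact ⟨i, rfl, hj.eq_of_multicast hr' (hk' i)⟩
  obtain ⟨T₁, hT₁t, hT₁⟩ := Run.delivered_or_blocked hr' hs' ha' hst'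
  -- late chosen messages do not block each other, so they are delivered once they are committed
  have hdeliv : ∀ i, T₁ < r.time (k (T i)) → ∀ n, U (T i) < r'.time n →
      r'.PartiallyDeliveredBefore S (m (T i)) n := by
    intro i hi n hn g hg
    obtain ⟨c, hc, htc, hcU⟩ := hcommit' i g hg
    rcases hT₁ _ _ _ (hk' i) (htk' i ▸ hi) g hg c htc.le hc with ⟨j, hj, hjc⟩ |
      ⟨a, q, m', hne, hq, hta, hac, hg', hpend⟩
    · exact ⟨j, Run.index_lt_of_time_lt hr' (hjc.trans_lt (hcU.trans_lt hn)), _,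
        hst'.leader_mem g, hj⟩
    exfalso
    obtain ⟨j, rfl, rfl⟩ := hchosen a q m' hq hta
    rcases lt_trichotomy i j with hij | rfl | hij
    · exact absurd ((hr'.time_mono hac).trans hcU) (not_le.2 (htk' j ▸ hsep i j hij))
    · exact hne rfl
    · obtain ⟨b, hb, htb, hbU⟩ := hcommit' j g hg'
      have hkc := Run.multicast_lt_commit hr' hs' hst' (hk' i) htc.le hc
      have hbk : b < k' i := Run.index_lt_of_time_lt hr'
        (hbU.trans_lt ((hsep j i hij).trans_eq (htk' i).symm))
      exact ((Phase.pending_iff _).1 hpend).2 (Run.phase_eq_committed_of_le hr' hs' hst'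
        (htb.le.trans (hr'.time_mono b.le_succ)) (by omega)
        (Run.commit_of_stable hr' hs' hst' htb.le hb).2).1
  obtain ⟨N, hN⟩ := eventually_atTop.1 (Run.eventually_partiallyDelivered hr' ha' T₁)
  obtain ⟨t', -, hD⟩ := h r' hrA'
  obtain ⟨i, hi⟩ := hlarge (max (max T₁ t') (r'.time N))
  have hiT₁ : T₁ < r.time (k (T i)) :=
    ((le_max_left _ _).trans (le_max_left _ _)).trans_lt hi
  have hit' : t' < r'.time (k' i) :=
    htk' i ▸ ((le_max_right _ _).trans (le_max_left _ _)).trans_lt hi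
  have hNi : N < k' i := Run.index_lt_of_time_lt hr' (htk' i ▸ (le_max_right _ _).trans_lt hi)
  have hcf : r'.CollisionFree S (m (T i)) := by
    rintro m' hne ⟨b, q, hq, hb⟩ - ⟨a, pa, b', pb, ha1, hb1, hnd, hnd'⟩
    obtain rfl := (hk' i).eq_of_multicast hr' ha1
    obtain rfl := hb.eq_of_multicast hr' hb1
    rcases le_or_gt (r'.time b) T₁ with hbT | hbT
    · exact hnd' (hN _ hNi.le b hbT q m' hq hb)
    obtain ⟨j, rfl, rfl⟩ := hchosen b q m' hb (lt_of_le_of_lt hT₁t hbT)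
    rcases lt_trichotomy i j with hij | rfl | hij
    · exact hnd (hdeliv i hiT₁ _ (htk' j ▸ hsep i j hij))
    · exact hne rfl
    · exact hnd' (hdeliv j (htk' j ▸ hbT) _ (htk' i ▸ hsep j i hij))
  obtain ⟨g, hg, hgl⟩ := hlate (T i)
  obtain ⟨n, q, hq, hn, hnD⟩ := hD _ _ _ (hk' i) hit' hcf g hg
  have hti : t < r'.time (k' i) := htk' i ▸ htT i
  obtain ⟨j, hjn, hkj, -, hdel⟩ := Run.leader_delivers_first hr' hs' ha' hst' (hk' i) hti hn hq
  obtain ⟨c, -, hcj, hc⟩ := Run.exists_commit_of_deliverable hr' hs' hst' (hk' i) hti hkj hdel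
  obtain ⟨c', hc', hcc'⟩ := (hcommit i g hg _).1 ⟨c, hc, rfl⟩
  have h1 : r'.time c ≤ r'.time n := hr'.time_mono (by omega)
  have h2 := hgl c' hc'
  rw [htk' i] at hnD
  linarith

end AtomicMulticast

theorem mainTheorem3 {P G M Pkt : Type*} [Fintype P] [Fintype G] [LinearOrder G]
    (S : AtomicMulticast.System P G M) (δ : ℝ≥0)
    (A : Set (AtomicMulticast.Run P G M Pkt))
    (hA : AtomicMulticast.SkeenBasedMulticast S δ A) :
    AtomicMulticast.collisionFreeLatency S A = AtomicMulticast.commitLatency S A ∧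
      ∀ D : ℝ≥0, AtomicMulticast.HasCollisionFreeLatency S A D ↔
        AtomicMulticast.HasCommitLatency S A D := by
  have h : ∀ D : ℝ≥0, AtomicMulticast.HasCollisionFreeLatency S A D ↔
      AtomicMulticast.HasCommitLatency S A D := fun D =>
    ⟨fun h => h.hasCommitLatency hA, fun h => h.hasCollisionFreeLatency hA⟩
  refine ⟨?_, h⟩
  simp only [AtomicMulticast.collisionFreeLatency, AtomicMulticast.commitLatency, h]
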